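/- Let $\mathbf{C}=\{0,1\}^{\infty}$ be the set of infinite binary sequences; for $S\in\mathbf{C}$ and $n\in\mathbb{N}$ let $S\upharpoonright n$ be the string of the first $n$ bits of $S$. An odds function is a function $O:\{0,1\}^*\to\mathbb{Q}\cap[1,2]$; it is acceptable if $\prod_{n\in\mathbb{N}}O(S\upharpoonright n)=\infty$ for every $S\in\mathbf{C}$. An $O$-supermartingale is a function $d:\{0,1\}^*\to[0,\infty)$ with $d(w)\ge \frac{d(w0)}{O(w0)}+\frac{d(w1)}{O(w1)}$ for all $w\in\{0,1\}^*$. Consider functionals $F$ that assign to each acceptable odds function $O$ a function $F^O:\{0,1\}^*\to[0,\infty)$. Such an $F$ is computable (respectively algorithmic, i.e. lower semicomputable) if there is one oracle Turing machine $M$ such that, for every acceptable $O$, $M$ with oracle $O$ halts on every input $(r,x)\in\mathbb{N}\times\{0,1\}^*$ and outputs a rational $g(r,x)\ge 0$, where $|g(r,x)-F^O(x)|\le 2^{-r}$ for all $r,x$ (respectively $g(r,x)\le g(r+1,x)\le F^O(x)$ for all $r,x$, and $\lim_{r\to\infty}g(r,x)=F^O(x)$ for all $x$). A set $X\subseteq\mathbf{C}$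 has computable (respectively algorithmic) strong packing dimension zero if there is a computable (respectively algorithmic) functional $F$ such that for every acceptable odds function $O$, $F^O$ is an $O$-supermartingale and $\liminf_{n\to\infty}F^O(S\upharpoonright n)=\infty$ for all $S\in X$. A sequence $S$ has one of these properties if $\{S\}$ has it. Theorem. If a sequence $S\in\mathbf{C}$ has algorithmic or computable strong packing dimension zero, then $S$ is decidable, i.e. $n\mapsto S(n)$ is a computable function. -/

import Mathlib

open scoped NNReal ENNReal NNRat

/-! ### Strings, sequences, odds functions and supermartingales -/

/-- Infinite binary sequences. -/
abbrev Cantor : Type := ℕ → Bool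

/-- The string consisting of the first `n` bits of the sequence `S`. -/
def Cantor.take (S : Cantor) (n : ℕ) : List Bool := (List.range n).map S

/-- Odds functions with rational values in the interval `[1, 2]`. -/
abbrev OddsFn : Type := List Bool → Set.Icc (1 : ℚ≥0) 2

/-- `O` is acceptable if, along every infinite sequence `S`, the infinite product of the odds
of all proper prefixes of `S` (the empty string included) diverges to infinity. -/
def OddsFn.Acceptable (O : OddsFn) : Prop :=
  ∀ S : Cantor, Filter.Tendsto
    (fun n : ℕ => ∏ i ∈ Finset.range n, ((O (S.take i) : ℚ≥0) : ℝ)) Filter.atTop Filter.atTop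

/-- `d` is an `O`-supermartingale: `d(w0)/O(w0) + d(w1)/O(w1) ≤ d(w)` for every string `w`. -/
def IsOddsSupermartingale (O : OddsFn) (d : List Bool → ℝ≥0) : Prop :=
  ∀ w : List Bool,
    d (w ++ [false]) / ((O (w ++ [false]) : ℚ≥0) : ℝ≥0) +
      d (w ++ [true]) / ((O (w ++ [true]) : ℚ≥0) : ℝ≥0) ≤ d w

/-! ### Oracle machines -/

/-- Programs for partial recursive functions with an oracle: the program syntax for partial
recursive functions, with an additional instruction that queries the oracle. -/
inductive OracleMachine : Type
  | zero : OracleMachine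
  | succ : OracleMachine
  | left : OracleMachine
  | right : OracleMachine
  | oracle : OracleMachine
  | pair : OracleMachine → OracleMachine → OracleMachine
  | comp : OracleMachine → OracleMachine → OracleMachine
  | prec : OracleMachine → OracleMachine → OracleMachine
  | rfind : OracleMachine → OracleMachine

/-- The partial function computed by an oracle machine with oracle `φ`.  Undefinedness
(`Part.none`) is divergence.  The program does not depend on `φ`. -/
def OracleMachine.eval (φ : ℕ → ℕ) : OracleMachine → (ℕ →. ℕ)
  | .zero => fun _ => Part.some 0
  | .succ => fun n => Part.some (n + 1)
  | .left => fun n => Part.some n.unpair.1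
  | .right => fun n => Part.some n.unpair.2
  | .oracle => fun n => Part.some (φ n)
  | .pair c₁ c₂ => fun n => Nat.pair <$> eval φ c₁ n <*> eval φ c₂ n
  | .comp c₁ c₂ => fun n => eval φ c₂ n >>= eval φ c₁
  | .prec c₁ c₂ => fun p =>
      Nat.rec (motive := fun _ => Part ℕ) (eval φ c₁ p.unpair.1)
        (fun y ih => ih >>= fun i => eval φ c₂ (Nat.pair p.unpair.1 (Nat.pair y i)))
        p.unpair.2
  | .rfind c => fun a => Nat.rfind fun n => (fun m => decide (m = 0)) <$> eval φ c (Nat.pair a n)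

/-- The code of a nonnegative rational: numerator and denominator in lowest terms. -/
def ratCode (q : ℚ≥0) : ℕ := Nat.pair q.num q.den

/-- An odds function as an oracle: queried at the code of a string `w`, it answers the code of
the rational number `O w` (and `0` at numbers that code no string). -/
def OddsFn.toOracle (O : OddsFn) (n : ℕ) : ℕ :=
  match Encodable.decode (α := List Bool) n with
  | some w => ratCode (O w : ℚ≥0)
  | none => 0

/-- With oracle `O`, the machine `M` halts on every input `(r, x)`, and outputs `g r x`. -/
def OracleMachine.Computes (M : OracleMachine) (O : OddsFn) (g : ℕ → List Bool → ℚ≥0) : Prop :=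
  ∀ (r : ℕ) (x : List Bool),
    M.eval O.toOracle (Encodable.encode (r, x)) = Part.some (ratCode (g r x))

/-! ### Computable and lower semicomputable functionals -/

/-- `g` is an approximation of `f` with error at most `2⁻ʳ` at stage `r`. -/
def IsComputation (g : ℕ → List Bool → ℚ≥0) (f : List Bool → ℝ≥0) : Prop :=
  ∀ (r : ℕ) (x : List Bool), |((g r x : ℚ≥0) : ℝ) - (f x : ℝ)| ≤ ((2 : ℝ) ^ r)⁻¹

/-- `g` is a nondecreasing approximation of `f` from below. -/
def IsLowerComputation (g : ℕ → List Bool → ℚ≥0) (f : List Bool → ℝ≥0) : Prop :=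
  (∀ (r : ℕ) (x : List Bool), g r x ≤ g (r + 1) x ∧ ((g (r + 1) x : ℚ≥0) : ℝ) ≤ (f x : ℝ)) ∧
    ∀ x : List Bool,
      Filter.Tendsto (fun r : ℕ => ((g r x : ℚ≥0) : ℝ)) Filter.atTop (nhds (f x : ℝ))

/-- The functional `F` on acceptable odds functions is computable: a single oracle machine
computes, from every acceptable `O`, an approximation of `F O` with error `2⁻ʳ`. -/
def ComputableFunctional (F : OddsFn → List Bool → ℝ≥0) : Prop :=
  ∃ M : OracleMachine, ∀ O : OddsFn, O.Acceptable →
    ∃ g : ℕ → List Bool → ℚ≥0, M.Computes O g ∧ IsComputation g (F O)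

/-- The functional `F` on acceptable odds functions is lower semicomputable (algorithmic): a
single oracle machine computes, from every acceptable `O`, an approximation of `F O` from below. -/
def AlgorithmicFunctional (F : OddsFn → List Bool → ℝ≥0) : Prop :=
  ∃ M : OracleMachine, ∀ O : OddsFn, O.Acceptable →
    ∃ g : ℕ → List Bool → ℚ≥0, M.Computes O g ∧ IsLowerComputation g (F O)

/-! ### Strong packing dimension zero -/

/-- For every acceptable `O`, `F O` is an `O`-supermartingale whose values along every `S ∈ X`
have limit inferior `∞`. -/
def SucceedsInLiminf (F : OddsFn → List Bool → ℝ≥0) (X : Set Cantor) : Prop :=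
  ∀ O : OddsFn, O.Acceptable →
    IsOddsSupermartingale O (F O) ∧
      ∀ S ∈ X, Filter.liminf (fun n : ℕ => (F O (S.take n) : ℝ≥0∞)) Filter.atTop = ⊤

/-- `X` has computable strong packing dimension zero. -/
def ComputableSPDZ (X : Set Cantor) : Prop :=
  ∃ F : OddsFn → List Bool → ℝ≥0, ComputableFunctional F ∧ SucceedsInLiminf F X

/-- `X` has algorithmic strong packing dimension zero. -/
def AlgorithmicSPDZ (X : Set Cantor) : Prop :=
  ∃ F : OddsFn → List Bool → ℝ≥0, AlgorithmicFunctional F ∧ SucceedsInLiminf F X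

/-- The sequence `S` is decidable: there is an algorithm that decides, given `n`, whether the
bit of `S` at position `n` is `1`. -/
def Cantor.IsDecidable (S : Cantor) : Prop := ComputablePred fun n : ℕ => S n = true

/-! ### Oracle machines: uniform computability and finite use -/

/-! Only the odds `levelOdds b` are needed, with `b` marking infinitely many levels. Write f b for
`F (levelOdds b)`. Since a halting computation has finite use, f b w > c is an open and uniformly
semidecidable condition on `b`.

Call a finite piece of `b` a stem. A Baire category argument over stems (`exists_generic`) gives a
stem and an N such that, for n ≥ N, every further extension of the stem can be extended to some `b`
with f b (S↾n) > 1 (`exists_forced_success`). Otherwise a generic `b` would defeat f b on S. A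
second such argument (`LowerOpen.exists_bound`) lengthens the stem to m₁ bits so that f b [] ≤ C for
all `b` extending it.

If `b` extends this stem and is false from m₁ through n, nothing is gained on those levels, so at
most 2^m₁ * C strings of length n have value above 1 (`IsOddsSupermartingale.card_le`). A set of
such strings with a common `b` can always be enlarged by S↾n: fix enough of `b` to keep the values
above 1, then extend it as above (`JointlyLarge.insert_take`). Sets of the largest size that recurs
at arbitrarily long lengths must therefore already contain S↾n, once n is large.

This is an enumerable family of sets of bounded size, each containing a prefix of S. By
`exists_branching_level`, for a suitable fixed l and every n, some set in the family has all its
members that extend S↾l agreeing at position n. Searching for such a set computes S(n). -/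

theorem OracleMachine.eval_comp (φ : ℕ → ℕ) (c₁ c₂ : OracleMachine) (n : ℕ) :
    (OracleMachine.comp c₁ c₂).eval φ n = (c₂.eval φ n).bind fun x => c₁.eval φ x := rfl

theorem OracleMachine.eval_prec (φ : ℕ → ℕ) (c₁ c₂ : OracleMachine) (n : ℕ) :
    (OracleMachine.prec c₁ c₂).eval φ n =
      Nat.rec (motive := fun _ => Part ℕ) (c₁.eval φ n.unpair.1)
        (fun y ih => ih.bind fun i => c₂.eval φ (Nat.pair n.unpair.1 (Nat.pair y i)))
        n.unpair.2 := rfl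

theorem OracleMachine.eval_rfind (φ : ℕ → ℕ) (c : OracleMachine) (n : ℕ) :
    (OracleMachine.rfind c).eval φ n =
      Nat.rfind fun k => (c.eval φ (Nat.pair n k)).map fun m => decide (m = 0) := rfl

theorem Computable.natPair {α : Type*} [Primcodable α] {f g : α → ℕ} (hf : Computable f)
    (hg : Computable g) : Computable fun a => Nat.pair (f a) (g a) :=
  Primrec₂.natPair.to_comp.comp hf hg

/-- Uniformity in the parameter `a` is what lets one search run the machine on all stems at once. -/
theorem OracleMachine.eval_partrec {α : Type*} [Primcodable α] {φ : α → ℕ → ℕ}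
    (hφ : Computable₂ φ) (M : OracleMachine) :
    Partrec fun p : α × ℕ => M.eval (φ p.1) p.2 := by
  induction M with
  | zero => exact Computable.const 0
  | succ => exact Computable.succ.comp Computable.snd
  | left => exact Computable.fst.comp (Computable.unpair.comp Computable.snd)
  | right => exact Computable.snd.comp (Computable.unpair.comp Computable.snd)
  | oracle => exact hφ.comp Computable.fst Computable.snd
  | pair c₁ c₂ h₁ h₂ =>
    refine (Partrec.bind h₁ (g := fun p x => (c₂.eval (φ p.1) p.2).map (Nat.pair x)) ?_).of_eq ?_
    · refine Partrec.map (h₂.comp Computable.fst) (g := fun q y => Nat.pair q.2 y) ?_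
      exact Primrec₂.natPair.to_comp.comp (Computable.snd.comp Computable.fst) Computable.snd
    · intro p
      simp [OracleMachine.eval, Seq.seq]
  | comp c₁ c₂ h₁ h₂ =>
    have h : Partrec₂ fun (p : α × ℕ) (x : ℕ) => c₁.eval (φ p.1) x :=
      h₁.comp (Computable.pair (Computable.fst.comp Computable.fst) Computable.snd)
    exact (Partrec.bind h₂ h).of_eq fun p => (OracleMachine.eval_comp _ _ _ _).symm
  | prec c₁ c₂ h₁ h₂ =>
    have hu : Computable fun p : α × ℕ => p.2.unpair := Computable.unpair.comp Computable.snd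
    have h : Partrec₂ fun (p : α × ℕ) (q : ℕ × ℕ) =>
        c₂.eval (φ p.1) (Nat.pair p.2.unpair.1 (Nat.pair q.1 q.2)) := by
      have h3 : Computable fun x : (α × ℕ) × (ℕ × ℕ) => Nat.pair x.2.1 x.2.2 :=
        Computable.natPair (Computable.fst.comp Computable.snd) (Computable.snd.comp Computable.snd)
      have h4 : Computable fun x : (α × ℕ) × (ℕ × ℕ) =>
          Nat.pair x.1.2.unpair.1 (Nat.pair x.2.1 x.2.2) :=
        Computable.natPair (Computable.fst.comp (hu.comp Computable.fst)) h3
      exact h₂.comp (Computable.pair (Computable.fst.comp Computable.fst) h4)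
    have hf : Computable fun p : α × ℕ => p.2.unpair.2 := Computable.snd.comp hu
    have hg : Partrec fun p : α × ℕ => c₁.eval (φ p.1) p.2.unpair.1 :=
      h₁.comp (Computable.pair Computable.fst (Computable.fst.comp hu))
    exact Partrec.nat_rec hf hg h
  | rfind c h =>
    have h3 : Computable fun q : (α × ℕ) × ℕ => Nat.pair q.1.2 q.2 :=
      Computable.natPair (Computable.snd.comp Computable.fst) Computable.snd
    have h' : Partrec fun q : (α × ℕ) × ℕ => c.eval (φ q.1.1) (Nat.pair q.1.2 q.2) :=
      h.comp (Computable.pair (Computable.fst.comp Computable.fst) h3)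
    have hd : Computable₂ fun (_ : (α × ℕ) × ℕ) (m : ℕ) => decide (m = 0) :=
      (Primrec.eq.decide.comp Primrec.id (Primrec.const 0)).to_comp.comp Computable.snd
    have hp : Partrec₂ fun (p : α × ℕ) (n : ℕ) =>
      (c.eval (φ p.1) (Nat.pair p.2 n)).map fun m => decide (m = 0) := Partrec.map h' hd
    exact (Partrec.rfind hp).of_eq fun p => (OracleMachine.eval_rfind _ _ _).symm

theorem OracleMachine.eval_comp_partrec {α β : Type*} [Primcodable α] [Primcodable β]
    {φ : α → ℕ → ℕ} (hφ : Computable₂ φ) (M : OracleMachine) {f : β → α} {g : β → ℕ}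
    (hf : Computable f) (hg : Computable g) : Partrec fun x => M.eval (φ (f x)) (g x) :=
  (M.eval_partrec hφ).comp (Computable.pair hf hg)

/-- A halting computation queries only finitely many values of the oracle. -/
theorem OracleMachine.exists_use (M : OracleMachine) (φ : ℕ → ℕ) {n v : ℕ} (h : v ∈ M.eval φ n) :
    ∃ m, ∀ ψ : ℕ → ℕ, (∀ i < m, ψ i = φ i) → v ∈ M.eval ψ n := by
  induction M generalizing n v with
  | zero => exact ⟨0, fun ψ _ => h⟩
  | succ => exact ⟨0, fun ψ _ => h⟩
  | left => exact ⟨0, fun ψ _ => h⟩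
  | right => exact ⟨0, fun ψ _ => h⟩
  | oracle =>
    refine ⟨n + 1, fun ψ hψ => ?_⟩
    simp only [OracleMachine.eval, Part.mem_some_iff] at h ⊢
    rw [h, hψ n n.lt_succ_self]
  | pair c₁ c₂ h₁ h₂ =>
    simp only [OracleMachine.eval, Seq.seq, Part.map_eq_map, Part.mem_bind_iff,
      Part.mem_map_iff, exists_exists_and_eq_and] at h ⊢
    obtain ⟨a, ha, b, hb, rfl⟩ := h
    obtain ⟨m₁, hm₁⟩ := h₁ ha
    obtain ⟨m₂, hm₂⟩ := h₂ hb
    exact ⟨max m₁ m₂, fun ψ hψ => ⟨a, hm₁ ψ fun i hi => hψ i (lt_max_of_lt_left hi), b,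
      hm₂ ψ fun i hi => hψ i (lt_max_of_lt_right hi), rfl⟩⟩
  | comp c₁ c₂ h₁ h₂ =>
    simp only [OracleMachine.eval_comp, Part.mem_bind_iff] at h ⊢
    obtain ⟨a, ha, hb⟩ := h
    obtain ⟨m₁, hm₁⟩ := h₁ hb
    obtain ⟨m₂, hm₂⟩ := h₂ ha
    exact ⟨max m₁ m₂, fun ψ hψ => ⟨a, hm₂ ψ fun i hi => hψ i (lt_max_of_lt_right hi),
      hm₁ ψ fun i hi => hψ i (lt_max_of_lt_left hi)⟩⟩
  | prec c₁ c₂ h₁ h₂ =>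
    simp only [OracleMachine.eval_prec] at h ⊢
    generalize n.unpair.2 = k at h ⊢
    induction k generalizing v with
    | zero => exact h₁ h
    | succ k ih =>
      simp only [Part.mem_bind_iff] at h ⊢
      obtain ⟨a, ha, hb⟩ := h
      obtain ⟨m₁, hm₁⟩ := ih ha
      obtain ⟨m₂, hm₂⟩ := h₂ hb
      exact ⟨max m₁ m₂, fun ψ hψ => ⟨a, hm₁ ψ fun i hi => hψ i (lt_max_of_lt_left hi),
        hm₂ ψ fun i hi => hψ i (lt_max_of_lt_right hi)⟩⟩
  | rfind c hc =>
    have hmem : ∀ ψ : ℕ → ℕ, v ∈ (OracleMachine.rfind c).eval ψ n ↔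
        (∃ a ∈ c.eval ψ (Nat.pair n v), decide (a = 0) = true) ∧
          ∀ {j : ℕ}, j < v → ∃ a ∈ c.eval ψ (Nat.pair n j), decide (a = 0) = false := fun ψ =>
      Nat.mem_rfind.trans (and_congr (Part.mem_map_iff _)
        (forall_congr' fun _ => imp_congr_right fun _ => Part.mem_map_iff _))
    simp only [hmem] at h ⊢
    obtain ⟨⟨a, ha, ha0⟩, hlt⟩ := h
    obtain ⟨m₁, hm₁⟩ := hc ha
    have key : ∀ j, ∃ m, j < v → ∀ ψ : ℕ → ℕ, (∀ i < m, ψ i = φ i) →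
        ∃ a, a ∈ c.eval ψ (Nat.pair n j) ∧ decide (a = 0) = false := by
      intro j
      by_cases hj : j < v
      · obtain ⟨b, hb, hb0⟩ := hlt hj
        obtain ⟨m, hm⟩ := hc hb
        exact ⟨m, fun _ ψ hψ => ⟨b, hm ψ hψ, hb0⟩⟩
      · exact ⟨0, fun h => absurd h hj⟩
    -- An unbounded search that stops at `v` has run only the computations for j ≤ v, so the maximum
    -- of their uses suffices.
    choose m hm using key
    refine ⟨max m₁ ((Finset.range v).sup m), fun ψ hψ =>
      ⟨⟨a, hm₁ ψ fun i hi => hψ i (lt_max_of_lt_left hi), ha0⟩, fun {j} hj => hm j hj ψ fun i hi =>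
        hψ i (lt_max_of_lt_right (hi.trans_le ?_))⟩⟩
    exact Finset.le_sup (f := m) (Finset.mem_range.2 hj)

/-! ### Recursively enumerable predicates -/

/-- Dovetailing: `k` codes a stage `r` together with a step bound for the computation. A primitive
recursive matrix allows bounded quantification over it later. -/
theorem Partrec.exists_primrecPred {α : Type*} [Primcodable α] {f : α × ℕ →. ℕ} (hf : Partrec f)
    {t : ℕ × ℕ → Prop} (ht : PrimrecPred t) :
    ∃ q : α × ℕ → Prop, PrimrecPred q ∧
      ∀ a, (∃ r v, v ∈ f (a, r) ∧ t (r, v)) ↔ ∃ k, q (a, k) := by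
  obtain ⟨code, hcode⟩ := Nat.Partrec.Code.exists_code.1 hf
  have hmem : ∀ a r v, v ∈ f (a, r) ↔
      ∃ k, Nat.Partrec.Code.evaln k code (Encodable.encode (a, r)) = some v := by
    intro a r v
    have h1 : v ∈ f (a, r) ↔ v ∈ code.eval (Encodable.encode (a, r)) := by
      rw [hcode]
      simp only [Encodable.encodek, Part.coe_some, Part.bind_some, Part.mem_map_iff,
        Encodable.encode_nat, exists_eq_right]
    exact h1.trans Nat.Partrec.Code.evaln_complete
  obtain ⟨_, ht⟩ := ht
  let q : α × ℕ → Bool := fun p =>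
    (Option.map (fun v => decide (t (p.2.unpair.1, v)))
      (Nat.Partrec.Code.evaln p.2.unpair.2 code (Encodable.encode (p.1, p.2.unpair.1)))).getD false
  have hq : Primrec q := by
    have hu : Primrec fun p : α × ℕ => p.2.unpair := Primrec.unpair.comp Primrec.snd
    refine Primrec.option_getD.comp (Primrec.option_map
      (Nat.Partrec.Code.primrec_evaln.comp (Primrec.pair (Primrec.pair (Primrec.snd.comp hu)
        (Primrec.const code)) (Primrec.encode.comp (Primrec.pair Primrec.fst
          (Primrec.fst.comp hu))))) ?_) (Primrec.const false)
    exact ht.comp (Primrec.pair (Primrec.fst.comp (hu.comp Primrec.fst)) Primrec.snd)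
  have hq' : ∀ a k, q (a, k) = true ↔ ∃ v, Nat.Partrec.Code.evaln k.unpair.2 code
      (Encodable.encode (a, k.unpair.1)) = some v ∧ t (k.unpair.1, v) := by
    intro a k
    simp only [q]
    cases Nat.Partrec.Code.evaln k.unpair.2 code (Encodable.encode (a, k.unpair.1)) <;> simp
  refine ⟨fun p => q p = true, Primrec.eq.comp hq (Primrec.const true), fun a => ?_⟩
  simp only [hq']
  constructor
  · rintro ⟨r, v, hv, hrv⟩
    obtain ⟨k, hk⟩ := (hmem a r v).1 hv
    exact ⟨Nat.pair r k, v, by simpa only [Nat.unpair_pair] using ⟨hk, hrv⟩⟩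
  · rintro ⟨k, v, hv, ht⟩
    exact ⟨_, v, (hmem a _ v).2 ⟨_, hv⟩, ht⟩

theorem REPred.of_exists {α β : Type*} [Primcodable α] [Primcodable β] {p : α → Prop}
    {q : α × β → Prop} (hq : PrimrecPred q) (h : ∀ a, p a ↔ ∃ b, q (a, b)) : REPred p := by
  obtain ⟨_, hq⟩ := hq
  have hc : Computable₂ fun (a : α) (n : ℕ) =>
      (((Encodable.decode n : Option β).map fun b => decide (q (a, b))).getD false) := by
    refine Primrec.to_comp (Primrec.option_getD.comp (Primrec.option_map
      (Primrec.decode.comp Primrec.snd) (g := fun x b => decide (q (x.1, b))) ?_)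
      (Primrec.const false))
    exact hq.comp (Primrec.pair (Primrec.fst.comp Primrec.fst) Primrec.snd)
  refine (Partrec.rfind hc.partrec₂).dom_re.of_eq fun a => ?_
  rw [h, Nat.rfind_dom]
  constructor
  · rintro ⟨n, hn, -⟩
    replace hn := Part.mem_some_iff.1 hn
    cases hd : (Encodable.decode n : Option β) with
    | none => simp [hd] at hn
    | some b => exact ⟨b, by simpa [hd] using hn⟩
  · rintro ⟨b, hb⟩
    exact ⟨Encodable.encode b, by simp [Encodable.encodek, hb], fun _ => trivial⟩

/-! ### Odds functions that depend only on the length of a string -/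

/-- `b` takes the value `true` infinitely often. -/
def InfinitelyOften (b : ℕ → Bool) : Prop := ∀ k, ∃ i, k ≤ i ∧ b i = true

/-- `b` and `b'` agree at all positions below `m`. -/
def AgreeBelow (m : ℕ) (b b' : ℕ → Bool) : Prop := ∀ i < m, b i = b' i

theorem AgreeBelow.trans {m : ℕ} {b b' b'' : ℕ → Bool} (h : AgreeBelow m b b')
    (h' : AgreeBelow m b' b'') : AgreeBelow m b b'' := fun i hi => (h i hi).trans (h' i hi)

theorem AgreeBelow.symm {m : ℕ} {b b' : ℕ → Bool} (h : AgreeBelow m b b') :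
    AgreeBelow m b' b := fun i hi => (h i hi).symm

theorem AgreeBelow.mono {m n : ℕ} {b b' : ℕ → Bool} (h : AgreeBelow m b b') (hn : n ≤ m) :
    AgreeBelow n b b' := fun i hi => h i (hi.trans_le hn)

/-- The odds are `2` on the strings whose length is marked by `b`, and `1` on all others. -/
def levelOdds (b : ℕ → Bool) : OddsFn := fun w =>
  if b w.length then ⟨2, by norm_num, le_rfl⟩ else ⟨1, le_rfl, by norm_num⟩

theorem levelOdds_val (b : ℕ → Bool) (w : List Bool) :
    (levelOdds b w : ℚ≥0) = if b w.length then 2 else 1 := by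
  unfold levelOdds; split_ifs <;> rfl

theorem Cantor.length_take (S : Cantor) (n : ℕ) : (S.take n).length = n := by
  simp [Cantor.take]

/-- Every marked level doubles the partial product, and no level decreases it. -/
theorem levelOdds_acceptable {b : ℕ → Bool} (hb : InfinitelyOften b) :
    (levelOdds b).Acceptable := by
  intro S
  simp only [levelOdds_val, Cantor.length_take]
  have hmono : Monotone fun n : ℕ =>
      ∏ i ∈ Finset.range n, (((if b i then 2 else 1 : ℚ≥0) : ℚ≥0) : ℝ) := by
    refine monotone_nat_of_le_succ fun n => ?_
    rw [Finset.prod_range_succ]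
    refine le_mul_of_one_le_right (Finset.prod_nonneg fun i _ => by positivity) ?_
    split_ifs <;> norm_num
  have hpow : ∀ k : ℕ, ∃ n, (2 : ℝ) ^ k ≤
      ∏ i ∈ Finset.range n, (((if b i then 2 else 1 : ℚ≥0) : ℚ≥0) : ℝ) := by
    intro k
    induction k with
    | zero => exact ⟨0, by simp⟩
    | succ k ih =>
      obtain ⟨n, hn⟩ := ih
      obtain ⟨i, hi, hbi⟩ := hb n
      refine ⟨i + 1, ?_⟩
      rw [Finset.prod_range_succ, pow_succ]
      refine mul_le_mul (hn.trans (hmono hi)) (by simp [hbi]) (by norm_num) ?_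
      exact Finset.prod_nonneg fun i _ => by positivity
  refine Filter.tendsto_atTop_atTop_of_monotone hmono fun x => ?_
  obtain ⟨k, hk⟩ := pow_unbounded_of_one_lt x (one_lt_two (α := ℝ))
  obtain ⟨n, hn⟩ := hpow k
  exact ⟨n, hk.le.trans hn⟩

/-- The answer at the code of `w` depends only on the bit of `b` at position `w.length`. -/
theorem levelOdds_toOracle_agree (b : ℕ → Bool) (m : ℕ) :
    ∃ m', ∀ b', AgreeBelow m' b b' → ∀ i < m, (levelOdds b').toOracle i = (levelOdds b).toOracle i := by
  refine ⟨(Finset.range m).sup (fun i => match Encodable.decode (α := List Bool) i with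
    | some w => w.length + 1
    | none => 0), fun b' h i hi => ?_⟩
  have hle := Finset.le_sup (f := fun i => match Encodable.decode (α := List Bool) i with
    | some w => w.length + 1
    | none => 0) (Finset.mem_range.2 hi)
  unfold OddsFn.toOracle
  cases hd : Encodable.decode (α := List Bool) i with
  | none => rfl
  | some w =>
    simp only [hd] at hle
    simp only [levelOdds_val, h w.length hle]

/-- The sequence that starts with `τ` and continues with `true`. -/
def padTrue (τ : List Bool) : ℕ → Bool := fun i => τ.getD i true

theorem padTrue_infinitelyOften (τ : List Bool) : InfinitelyOften (padTrue τ) := fun k =>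
  ⟨max k τ.length, le_max_left _ _, by simp [padTrue]⟩

theorem padTrue_take_agree (b : Cantor) (m : ℕ) : AgreeBelow m (padTrue (b.take m)) b := by
  intro i hi
  simp [padTrue, Cantor.take, hi]

theorem levelOdds_padTrue_computable :
    Computable₂ fun (τ : List Bool) (n : ℕ) => (levelOdds (padTrue τ)).toOracle n := by
  refine Primrec.to_comp ?_
  refine (Primrec.option_casesOn (o := fun p : List Bool × ℕ => Encodable.decode (α := List Bool) p.2)
    (f := fun _ => 0)
    (g := fun p w => bif p.1.getD w.length true then ratCode 2 else ratCode 1)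
    (Primrec.decode.comp Primrec.snd) (Primrec.const 0) ?_).of_eq ?_
  · have hg : Primrec fun q : (List Bool × ℕ) × List Bool => q.1.1.getD q.2.length true :=
      Primrec.option_getD.comp (Primrec.list_getElem?.comp (Primrec.fst.comp Primrec.fst)
        (Primrec.list_length.comp Primrec.snd)) (Primrec.const true)
    exact Primrec.cond hg (Primrec.const _) (Primrec.const _)
  · rintro ⟨τ, n⟩
    simp only [OddsFn.toOracle]
    cases Encodable.decode (α := List Bool) n with
    | none => rfl
    | some w =>
      simp only [levelOdds_val, padTrue]
      by_cases h : τ.getD w.length true = true <;> simp only [h] <;> rfl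

/-! ### Semidecidable lower bounds -/

/-- The test on a stage `r` and the code `v` of a rational that certifies a lower bound `c`: the
rational exceeds `c + ε * 2⁻ʳ`. -/
def exceedsTest (ε c r v : ℕ) : Prop := v.unpair.2 * (c * 2 ^ r + ε) < v.unpair.1 * 2 ^ r

theorem exceedsTest_ratCode (ε c r : ℕ) (q : ℚ≥0) :
    exceedsTest ε c r (ratCode q) ↔ (c : ℝ) + ε * ((2 : ℝ) ^ r)⁻¹ < (q : ℝ) := by
  have hd : (0 : ℝ) < (q.den : ℝ) := by exact_mod_cast q.den_pos
  have h2 : (0 : ℝ) < 2 ^ r := by positivity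
  have hq : ((q : ℚ≥0) : ℝ) = (q.num : ℝ) / (q.den : ℝ) := NNRat.cast_def q
  rw [exceedsTest, ratCode, Nat.unpair_pair, hq, lt_div_iff₀ hd, ← mul_lt_mul_iff_left₀ h2]
  have : ((c : ℝ) + ε * ((2 : ℝ) ^ r)⁻¹) * q.den * 2 ^ r = q.den * (c * 2 ^ r + ε) := by
    field_simp
  rw [this]
  exact_mod_cast Iff.rfl

theorem exceedsTest_primrecPred (ε c : ℕ) :
    PrimrecPred fun p : ℕ × ℕ => exceedsTest ε c p.1 p.2 := by
  have hpow : Primrec fun p : ℕ × ℕ => 2 ^ p.1 :=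
    (Primrec₂.unpaired'.1 Nat.Primrec.pow).comp (Primrec.const 2) Primrec.fst
  have hu : Primrec fun p : ℕ × ℕ => p.2.unpair := Primrec.unpair.comp Primrec.snd
  exact Primrec.nat_lt.comp
    (Primrec.nat_mul.comp (Primrec.snd.comp hu)
      (Primrec.nat_add.comp (Primrec.nat_mul.comp (Primrec.const c) hpow) (Primrec.const ε)))
    (Primrec.nat_mul.comp (Primrec.fst.comp hu) hpow)

/-- On acceptable odds functions, the machine `M` semidecides uniformly the lower bounds of the
values of `F`; the error allowed at stage `r` is `ε * 2⁻ʳ`. -/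
def Semidecides (M : OracleMachine) (ε : ℕ) (F : OddsFn → List Bool → ℝ≥0) : Prop :=
  ∀ O : OddsFn, O.Acceptable → ∀ (c : ℕ) (w : List Bool), (c : ℝ≥0) < F O w ↔
    ∃ r v, v ∈ M.eval O.toOracle (Encodable.encode (r, w)) ∧ exceedsTest ε c r v

theorem OracleMachine.Computes.exists_exceedsTest {M : OracleMachine} {O : OddsFn}
    {g : ℕ → List Bool → ℚ≥0} (h : M.Computes O g) (ε c : ℕ) (w : List Bool) :
    (∃ r v, v ∈ M.eval O.toOracle (Encodable.encode (r, w)) ∧ exceedsTest ε c r v) ↔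
      ∃ r, (c : ℝ) + ε * ((2 : ℝ) ^ r)⁻¹ < (g r w : ℝ) := by
  refine exists_congr fun r => ?_
  rw [h r w]
  simp [exceedsTest_ratCode]

theorem AlgorithmicFunctional.exists_semidecides {F : OddsFn → List Bool → ℝ≥0}
    (h : AlgorithmicFunctional F) : ∃ M, Semidecides M 0 F := by
  obtain ⟨M, hM⟩ := h
  refine ⟨M, fun O hO c w => ?_⟩
  obtain ⟨g, hg, hF, hlim⟩ := hM O hO
  rw [hg.exists_exceedsTest, ← NNReal.coe_lt_coe]
  simp only [NNReal.coe_natCast, Nat.cast_zero, zero_mul, add_zero]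
  constructor
  · exact fun hc => ((hlim w).eventually (lt_mem_nhds hc)).exists
  · rintro ⟨r, hr⟩
    refine hr.trans_le (le_trans ?_ (hF r w).2)
    exact_mod_cast (hF r w).1

theorem ComputableFunctional.exists_semidecides {F : OddsFn → List Bool → ℝ≥0}
    (h : ComputableFunctional F) : ∃ M, Semidecides M 1 F := by
  obtain ⟨M, hM⟩ := h
  refine ⟨M, fun O hO c w => ?_⟩
  obtain ⟨g, hg, hF⟩ := hM O hO
  rw [hg.exists_exceedsTest, ← NNReal.coe_lt_coe]
  simp only [NNReal.coe_natCast, Nat.cast_one, one_mul]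
  constructor
  · intro hc
    -- The error enters twice, in the approximation and in the test, so 2⁻ʳ must be below half of
    -- the gap.
    obtain ⟨r, hr⟩ := exists_pow_lt_of_lt_one (half_pos (sub_pos.2 hc)) (one_half_lt_one (α := ℝ))
    have := abs_le.1 (hF r w)
    rw [one_div, inv_pow] at hr
    exact ⟨r, by linarith⟩
  · rintro ⟨r, hr⟩
    have := abs_le.1 (hF r w)
    linarith

/-- The certifying computation queries the oracle finitely often, and each answer depends on one bit
of `b`. -/
theorem Semidecides.open {M : OracleMachine} {ε : ℕ} {F : OddsFn → List Bool → ℝ≥0}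
    (h : Semidecides M ε F) {b : ℕ → Bool} (hb : InfinitelyOften b) {c : ℕ} {w : List Bool}
    (hc : (c : ℝ≥0) < F (levelOdds b) w) :
    ∃ m, ∀ b', InfinitelyOften b' → AgreeBelow m b b' → (c : ℝ≥0) < F (levelOdds b') w := by
  obtain ⟨r, v, hv, ht⟩ := (h _ (levelOdds_acceptable hb) c w).1 hc
  obtain ⟨m, hm⟩ := M.exists_use _ hv
  obtain ⟨m', hm'⟩ := levelOdds_toOracle_agree b m
  exact ⟨m', fun b' hb' hbb' => (h _ (levelOdds_acceptable hb') c w).2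
    ⟨r, v, hm _ (hm' b' hbb'), ht⟩⟩

theorem Semidecides.exists_primrecPred {M : OracleMachine} {ε : ℕ} {F : OddsFn → List Bool → ℝ≥0}
    (h : Semidecides M ε F) (c : ℕ) :
    ∃ q : (List Bool × List Bool) × ℕ → Prop, PrimrecPred q ∧
      ∀ τ w, (c : ℝ≥0) < F (levelOdds (padTrue τ)) w ↔ ∃ k, q ((τ, w), k) := by
  have hi : Computable fun p : (List Bool × List Bool) × ℕ => (p.2, p.1.2) :=
    Computable.pair Computable.snd (Computable.snd.comp Computable.fst)
  have hf : Partrec fun p : (List Bool × List Bool) × ℕ =>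
      M.eval (levelOdds (padTrue p.1.1)).toOracle (Encodable.encode (p.2, p.1.2)) :=
    M.eval_comp_partrec levelOdds_padTrue_computable (Computable.fst.comp Computable.fst)
      (Computable.encode.comp hi)
  obtain ⟨q, hq, hqk⟩ := hf.exists_primrecPred (exceedsTest_primrecPred ε c)
  exact ⟨q, hq, fun τ w =>
    (h _ (levelOdds_acceptable (padTrue_infinitelyOften τ)) c w).trans (hqk (τ, w))⟩

/-! ### Generic sequences, and counting the strings of large value -/

/-- A sequence with infinitely many values `true` that meets countably many dense open sets. -/
theorem exists_generic {D : ℕ → Set (ℕ → Bool)} {b₀ : ℕ → Bool} {m₀ : ℕ}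
    (h : ∀ k b m, m₀ ≤ m → AgreeBelow m₀ b₀ b → ∃ b' m', AgreeBelow m b b' ∧
      ∀ b'', InfinitelyOften b'' → AgreeBelow m' b' b'' → b'' ∈ D k) :
    ∃ b, InfinitelyOften b ∧ AgreeBelow m₀ b₀ b ∧ ∀ k, b ∈ D k := by
  let X := {p : (ℕ → Bool) × ℕ // m₀ ≤ p.2 ∧ AgreeBelow m₀ b₀ p.1}
  have step : ∀ (k : ℕ) (p : X), ∃ p' : X, p.1.2 < p'.1.2 ∧ AgreeBelow p.1.2 p.1.1 p'.1.1 ∧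
      (∃ i, p.1.2 ≤ i ∧ i < p'.1.2 ∧ p'.1.1 i = true) ∧
      ∀ b'', InfinitelyOften b'' → AgreeBelow p'.1.2 p'.1.1 b'' → b'' ∈ D k := by
    rintro k ⟨⟨b, m⟩, hm, hb⟩
    obtain ⟨b', m', hbb', hD⟩ := h k b m hm hb
    -- An extra `true` is placed beyond everything fixed so far, which makes the limit sequence take
    -- that value infinitely often.
    have hag : AgreeBelow (max m m') b' (Function.update b' (max m m') true) := fun i hi =>
      (Function.update_of_ne hi.ne _ _).symm
    have hag' : AgreeBelow m b (Function.update b' (max m m') true) :=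
      hbb'.trans (hag.mono (le_max_left _ _))
    refine ⟨⟨(Function.update b' (max m m') true, max m m' + 1), ?_, hb.trans (hag'.mono hm)⟩,
      Nat.lt_succ_of_le (le_max_left _ _), hag',
      ⟨max m m', le_max_left _ _, Nat.lt_succ_self _, Function.update_self _ _ _⟩, ?_⟩
    · exact hm.trans ((le_max_left _ _).trans (Nat.le_succ _))
    · intro b'' hb'' hag''
      exact hD b'' hb'' ((hag.mono (le_max_right _ _)).trans
        (hag''.mono ((le_max_right _ _).trans (Nat.le_succ _))))
  choose next hlt hag htrue hD using step
  let s : ℕ → X := Nat.rec ⟨(b₀, m₀), le_rfl, fun _ _ => rfl⟩ next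
  have hs : ∀ k, s (k + 1) = next k (s k) := fun k => rfl
  have hmono : Monotone fun k => (s k).1.2 := monotone_nat_of_le_succ fun k => (hlt k (s k)).le
  have hge : ∀ k, k ≤ (s k).1.2 := by
    intro k
    induction k with
    | zero => exact Nat.zero_le _
    | succ k ih => exact Nat.succ_le_of_lt (ih.trans_lt (hlt k (s k)))
  have hagree : ∀ k l, k ≤ l → AgreeBelow (s k).1.2 (s k).1.1 (s l).1.1 := by
    intro k l hkl
    induction l, hkl using Nat.le_induction with
    | base => exact fun _ _ => rfl
    | succ l hkl ih => exact ih.trans ((hag l (s l)).mono (hmono hkl))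
  -- Bit `i` is read off at stage `i + 1`, where at least `i + 1` bits are already fixed.
  have hlim : ∀ k, AgreeBelow (s k).1.2 (s k).1.1 fun i => (s (i + 1)).1.1 i := by
    intro k i hi
    rcases le_total k (i + 1) with hk | hk
    · exact hagree k (i + 1) hk i hi
    · exact (hagree (i + 1) k hk i (hge (i + 1))).symm
  have hio : InfinitelyOften fun i => (s (i + 1)).1.1 i := by
    intro k
    obtain ⟨i, hki, hi, hti⟩ := htrue k (s k)
    exact ⟨i, (hge k).trans hki, by rw [← hlim (k + 1) i hi]; exact hti⟩
  exact ⟨_, hio, hlim 0, fun k => hD k (s k) _ hio (hlim (k + 1))⟩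

/-- Passing to the children at most doubles the total when their level is marked, and never
increases it otherwise. Only levels above `v.length` and below `m` can be marked in the relevant
range, which gives the exponent. -/
theorem IsOddsSupermartingale.sum_le {b : ℕ → Bool} {d : List Bool → ℝ≥0}
    (h : IsOddsSupermartingale (levelOdds b) d) (m n : ℕ) (v : List Bool)
    (hb : ∀ i, m ≤ i → i ≤ v.length + n → b i = false) (A : Finset (List Bool))
    (hA : ∀ w ∈ A, w.length = n) :
    ∑ w ∈ A, d (v ++ w) ≤ 2 ^ (m - v.length) * d v := by
  classical
  induction n generalizing v A with
  | zero =>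
    have hsub : A ⊆ {[]} := fun w hw => by simpa using hA w hw
    refine (Finset.sum_le_sum_of_subset hsub).trans ?_
    rw [Finset.sum_singleton, List.append_nil]
    exact le_mul_of_one_le_left (zero_le) (one_le_pow₀ one_le_two)
  | succ n ih =>
    have hinj : ∀ c : Bool, Function.Injective (List.cons c) := fun c _ _ h => (List.cons.inj h).2
    have hsplit : ∑ w ∈ A, d (v ++ w) =
        ∑ w ∈ A.preimage (List.cons false) (hinj false).injOn, d (v ++ [false] ++ w) +
          ∑ w ∈ A.preimage (List.cons true) (hinj true).injOn, d (v ++ [true] ++ w) := by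
      have hc : ∀ c : Bool, ∑ w ∈ A.preimage (List.cons c) (hinj c).injOn, d (v ++ [c] ++ w) =
          ∑ w ∈ A with w ∈ Set.range (List.cons c), d (v ++ w) := by
        intro c
        rw [← Finset.sum_preimage' (List.cons c) A (hinj c).injOn]
        simp
      rw [hc, hc, ← Finset.sum_filter_add_sum_filter_not A (· ∈ Set.range (List.cons false))]
      congr 1
      refine Finset.sum_congr (Finset.filter_congr fun w hw => ?_) fun _ _ => rfl
      have hl := hA w hw
      cases w with
      | nil => simp at hl
      | cons c w => cases c <;> simp
    have hsub : ∀ c : Bool, ∑ w ∈ A.preimage (List.cons c) (hinj c).injOn, d (v ++ [c] ++ w) ≤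
        2 ^ (m - (v.length + 1)) * d (v ++ [c]) := by
      intro c
      have := ih (v ++ [c]) (fun i hi hi' => hb i hi (by simp at hi'; omega))
        (A.preimage (List.cons c) (hinj c).injOn) (fun w hw => by
          have := hA _ (Finset.mem_preimage.1 hw)
          simpa using this)
      simpa using this
    have hv := h v
    simp only [levelOdds_val, List.length_append, List.length_singleton] at hv
    rw [hsplit]
    refine (add_le_add (hsub false) (hsub true)).trans ?_
    rw [← mul_add]
    by_cases hbv : b (v.length + 1) = true
    · have hlt : v.length + 1 < m := by
        by_contra hle
        have := hb (v.length + 1) (not_lt.1 hle) (by omega)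
        simp [hbv] at this
      have hm : m - v.length = (m - (v.length + 1)) + 1 := by omega
      rw [hm, pow_succ, mul_assoc]
      refine mul_le_mul_right ?_ _
      simp only [hbv, if_true, ← add_div] at hv
      have h2 : (0 : ℝ≥0) < (((2 : ℚ≥0) : ℚ≥0) : ℝ≥0) := by simp
      have := (div_le_iff₀ h2).1 hv
      simpa [mul_comm] using this
    · simp only [hbv] at hv
      simp only [Bool.false_eq_true, if_false, NNRat.cast_one, div_one] at hv
      exact mul_le_mul' (pow_le_pow_right₀ one_le_two (by omega)) hv

theorem IsOddsSupermartingale.card_le {b : ℕ → Bool} {d : List Bool → ℝ≥0}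
    (h : IsOddsSupermartingale (levelOdds b) d) {m n C : ℕ}
    (hb : ∀ i, m ≤ i → i ≤ n → b i = false) (hC : d [] ≤ C) (A : Finset (List Bool))
    (hA : ∀ w ∈ A, w.length = n) (hd : ∀ w ∈ A, 1 < d w) : A.card ≤ 2 ^ m * C := by
  have h1 := h.sum_le m n [] (by simpa using hb) A hA
  simp only [List.nil_append, List.length_nil, Nat.sub_zero] at h1
  have h2 : (A.card : ℝ≥0) ≤ ∑ w ∈ A, d w := by
    simpa using Finset.card_nsmul_le_sum A d 1 fun w hw => (hd w hw).le
  have h3 : (A.card : ℝ≥0) ≤ 2 ^ m * C := h2.trans (h1.trans (by gcongr))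
  exact_mod_cast h3

theorem exists_maximal_of_bounded {P : ℕ → Prop} {K : ℕ} (h0 : P 0) (hK : ∀ k, P k → k ≤ K) :
    ∃ k, P k ∧ ¬ P (k + 1) := by
  by_contra! hcon
  have : ∀ k, P k := fun k => Nat.rec h0 (fun k ih => hcon k ih) k
  exact absurd (hK _ (this (K + 1))) (by omega)

/-- In a family of sets of strings that have bounded size and contain arbitrarily long strings,
all branching that persists takes place below a fixed level. -/
theorem exists_branching_level {𝒜 : Set (Finset (List Bool))} {K : ℕ}
    (hK : ∀ A ∈ 𝒜, A.card ≤ K) (hlong : ∀ N, ∃ A ∈ 𝒜, ∀ w ∈ A, N ≤ w.length) :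
    ∃ l, ∀ n, ∃ A ∈ 𝒜, (∀ w ∈ A, n < w.length ∧ l ≤ w.length) ∧
      ∀ w ∈ A, ∀ w' ∈ A, w.take l = w'.take l → w[n]? = w'[n]? := by
  classical
  obtain ⟨k, ⟨l, hl⟩, hk⟩ := exists_maximal_of_bounded (K := K)
    (P := fun k => ∃ l, ∀ N, ∃ A ∈ 𝒜, (∀ w ∈ A, N ≤ w.length) ∧ k ≤ (A.image (List.take l)).card)
    ⟨0, fun N => by
      obtain ⟨A, hA, hN⟩ := hlong N
      exact ⟨A, hA, hN, Nat.zero_le _⟩⟩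
    (fun k ⟨l, hl⟩ => by
      obtain ⟨A, hA, -, hkA⟩ := hl 0
      exact hkA.trans (Finset.card_image_le.trans (hK A hA)))
  refine ⟨l, fun n => ?_⟩
  push Not at hk
  obtain ⟨N, hN⟩ := hk (max l (n + 1))
  obtain ⟨A, hA, hlen, hcard⟩ := hl (max N (max l (n + 1)))
  simp only [max_le_iff] at hlen
  refine ⟨A, hA, fun w hw => ⟨(hlen w hw).2.2, (hlen w hw).2.1⟩, fun w hw w' hw' hww' => ?_⟩
  have hlt := hN A hA fun w hw => (hlen w hw).1
  have himage : (A.image (List.take (max l (n + 1)))).image (List.take l) =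
      A.image (List.take l) := by
    rw [Finset.image_image]
    refine Finset.image_congr fun w _ => ?_
    simp [List.take_take]
  -- Cutting at `max l (n + 1)` yields at most `k` prefixes by maximality of `k`, and cutting at `l`
  -- still yields at least `k`; so the first `l` bits determine bit `n`.
  have hinj : Set.InjOn (List.take l)
      ((A.image (List.take (max l (n + 1))) : Finset (List Bool)) : Set (List Bool)) :=
    Finset.card_image_iff.1 (le_antisymm Finset.card_image_le
      (by rw [himage]; exact (Nat.le_of_lt_succ hlt).trans hcard))
  have heq := hinj (Finset.mem_coe.2 (Finset.mem_image_of_mem _ hw))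
    (Finset.mem_coe.2 (Finset.mem_image_of_mem _ hw')) (by simpa [List.take_take] using hww')
  have hn : n < max l (n + 1) := lt_max_of_lt_right n.lt_succ_self
  rw [← List.getElem?_take_of_lt hn, heq, List.getElem?_take_of_lt hn]

/-! ### Deciding the sequence -/

/-- `f b w` can be bounded from below by an initial segment of `b`. -/
def LowerOpen (f : (ℕ → Bool) → List Bool → ℝ≥0) : Prop :=
  ∀ b, InfinitelyOften b → ∀ (c : ℕ) (w : List Bool), (c : ℝ≥0) < f b w →
    ∃ m, ∀ b', InfinitelyOften b' → AgreeBelow m b b' → (c : ℝ≥0) < f b' w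

theorem LowerOpen.finset {f : (ℕ → Bool) → List Bool → ℝ≥0} (hf : LowerOpen f) {b : ℕ → Bool}
    (hb : InfinitelyOften b) (A : Finset (List Bool)) (hA : ∀ w ∈ A, 1 < f b w) :
    ∃ m, ∀ b', InfinitelyOften b' → AgreeBelow m b b' → ∀ w ∈ A, 1 < f b' w := by
  have : ∀ w, ∃ m, w ∈ A → ∀ b', InfinitelyOften b' → AgreeBelow m b b' → 1 < f b' w := by
    intro w
    by_cases hw : w ∈ A
    · obtain ⟨m, hm⟩ := hf b hb 1 w (by simpa using hA w hw)
      exact ⟨m, fun _ => by simpa using hm⟩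
    · exact ⟨0, fun h => absurd h hw⟩
  choose m hm using this
  exact ⟨A.sup m, fun b' hb' hag w hw => hm w hw b' hb' (hag.mono (Finset.le_sup hw))⟩

/-- If every stem and bound had a counterexample, a generic `b` would satisfy f b (S↾n) ≤ 1 for
infinitely many n. -/
theorem exists_forced_success {f : (ℕ → Bool) → List Bool → ℝ≥0} {S : Cantor}
    (hlim : ∀ b, InfinitelyOften b → ∃ N, ∀ n, N ≤ n → 1 < f b (S.take n)) :
    ∃ b₀ m₀ N, ∀ n, N ≤ n → ∀ b m, m₀ ≤ m → AgreeBelow m₀ b₀ b →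
      ∃ b', InfinitelyOften b' ∧ AgreeBelow m b b' ∧ 1 < f b' (S.take n) := by
  by_contra! hcon
  obtain ⟨b, hb, -, hD⟩ := exists_generic (b₀ := fun _ => true) (m₀ := 0)
    (D := fun k => {b | ∃ n, k ≤ n ∧ f b (S.take n) ≤ 1}) (by
      intro k b m _ _
      obtain ⟨n, hn, b', m', hm, hag, hle⟩ := hcon b m k
      exact ⟨b', m', hag, fun b'' hb'' hag'' => ⟨n, hn, hle b'' hb'' hag''⟩⟩)
  obtain ⟨N, hN⟩ := hlim b hb
  obtain ⟨n, hn, hle⟩ := hD N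
  exact absurd (hN n hn) (not_lt.2 hle)

/-- Otherwise "value above `k`" is dense and open for every `k`, and a generic `b` would have
infinite value at `w`. -/
theorem LowerOpen.exists_bound {f : (ℕ → Bool) → List Bool → ℝ≥0} (hf : LowerOpen f)
    (w : List Bool) (b₀ : ℕ → Bool) (m₀ : ℕ) :
    ∃ b₁ m₁, ∃ C : ℕ, m₀ ≤ m₁ ∧ AgreeBelow m₀ b₀ b₁ ∧
      ∀ b, InfinitelyOften b → AgreeBelow m₁ b₁ b → f b w ≤ C := by
  by_contra! hcon
  obtain ⟨b, -, -, hD⟩ := exists_generic (b₀ := b₀) (m₀ := m₀)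
    (D := fun k => {b | (k : ℝ≥0) < f b w}) (by
      intro k b m hm hag
      obtain ⟨b', hb', hag', hlt⟩ := hcon b m k hm hag
      obtain ⟨m', hm'⟩ := hf b' hb' k w hlt
      exact ⟨b', m', hag', hm'⟩)
  obtain ⟨k, hk⟩ := exists_nat_gt (f b w)
  exact absurd (hD k) (not_lt.2 hk.le)

/-- The strings in `A` have length `n`, and for some `b` that agrees with `b₁` below `m₁` and
vanishes from there up to `n`, all of them have value above `1`. -/
def JointlyLarge (f : (ℕ → Bool) → List Bool → ℝ≥0) (b₁ : ℕ → Bool) (m₁ n : ℕ)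
    (A : Finset (List Bool)) : Prop :=
  (∀ w ∈ A, w.length = n) ∧ ∃ b, InfinitelyOften b ∧ AgreeBelow m₁ b₁ b ∧
    (∀ i, m₁ ≤ i → i ≤ n → b i = false) ∧ ∀ w ∈ A, 1 < f b w

theorem JointlyLarge.insert_take {f : (ℕ → Bool) → List Bool → ℝ≥0} (hf : LowerOpen f) {S : Cantor}
    {b₁ : ℕ → Bool} {m₁ n : ℕ} {A : Finset (List Bool)}
    (hS : ∀ b m, m₁ ≤ m → AgreeBelow m₁ b₁ b →
      ∃ b', InfinitelyOften b' ∧ AgreeBelow m b b' ∧ 1 < f b' (S.take n))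
    (hA : JointlyLarge f b₁ m₁ n A) : JointlyLarge f b₁ m₁ n (insert (S.take n) A) := by
  obtain ⟨hlen, b, hb, hag, hzero, hlarge⟩ := hA
  obtain ⟨m, hm⟩ := hf.finset hb A hlarge
  -- The maximum protects the large values on `A`, the stem, and the block of zeros through `n`.
  obtain ⟨b', hb', hbb', hS'⟩ := hS b (max m (max m₁ (n + 1))) (by simp) hag
  refine ⟨fun w hw => ?_, b', hb', hag.trans (hbb'.mono (by simp)), fun i hi hin => ?_,
    fun w hw => ?_⟩
  · rcases Finset.mem_insert.1 hw with rfl | hw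
    exacts [S.length_take n, hlen w hw]
  · rw [← hbb' i (lt_max_of_lt_right (lt_max_of_lt_right (Nat.lt_succ_of_le hin)))]
    exact hzero i hi hin
  · rcases Finset.mem_insert.1 hw with rfl | hw
    exacts [hS', hm b' hb' (hbb'.mono (le_max_left _ _)) w hw]

/-- Jointly large sets of maximal size contain the prefixes of `S`. -/
theorem exists_jointlyLarge_family {f : (ℕ → Bool) → List Bool → ℝ≥0} (hf : LowerOpen f)
    (hsm : ∀ b, InfinitelyOften b → IsOddsSupermartingale (levelOdds b) (f b)) {S : Cantor}
    (hlim : ∀ b, InfinitelyOften b → ∃ N, ∀ n, N ≤ n → 1 < f b (S.take n)) :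
    ∃ b₁ m₁ N k K, (∀ n A, JointlyLarge f b₁ m₁ n A → A.card ≤ K) ∧
      (∀ n A, N ≤ n → JointlyLarge f b₁ m₁ n A → k ≤ A.card → S.take n ∈ A) ∧
      ∀ n, ∃ n' A, n ≤ n' ∧ JointlyLarge f b₁ m₁ n' A ∧ k ≤ A.card := by
  obtain ⟨b₀, m₀, N₀, hforce⟩ := exists_forced_success hlim
  obtain ⟨b₁, m₁, C, hm, hag, hC⟩ := hf.exists_bound [] b₀ m₀
  have hK : ∀ n A, JointlyLarge f b₁ m₁ n A → A.card ≤ 2 ^ m₁ * C := by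
    rintro n A ⟨hlen, b, hb, hagb, hzero, hlarge⟩
    exact (hsm b hb).card_le hzero (hC b hb hagb) A hlen hlarge
  have hinsert : ∀ n A, N₀ ≤ n → JointlyLarge f b₁ m₁ n A →
      JointlyLarge f b₁ m₁ n (insert (S.take n) A) := fun n A hn hA =>
    hA.insert_take hf fun b m hmm hagb =>
      hforce n hn b m (hm.trans hmm) (hag.trans (hagb.mono hm))
  -- The empty set starts the maximization at `k = 0`; its witness is `true` at every position
  -- beyond both `n` and the stem.
  have hempty : ∀ n, JointlyLarge f b₁ m₁ n ∅ := fun n =>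
    ⟨by simp, fun i => if i < m₁ then b₁ i else decide (n < i), fun k =>
      ⟨max k (max m₁ (n + 1)), le_max_left _ _, by simp⟩,
      fun i hi => by simp [hi], fun i hi hin => by simp [not_lt.2 hi, hin], by simp⟩
  obtain ⟨k, hk, hk'⟩ := exists_maximal_of_bounded (K := 2 ^ m₁ * C)
    (P := fun k => ∀ n, ∃ n' A, n ≤ n' ∧ JointlyLarge f b₁ m₁ n' A ∧ k ≤ A.card)
    (fun n => ⟨n, ∅, le_rfl, hempty n, Nat.zero_le _⟩)
    (fun k h => by
      obtain ⟨n', A, -, hA, hkA⟩ := h 0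
      exact hkA.trans (hK n' A hA))
  push Not at hk'
  obtain ⟨N, hN⟩ := hk'
  refine ⟨b₁, m₁, max N N₀, k, 2 ^ m₁ * C, hK, fun n A hn hA hkA => ?_, hk⟩
  by_contra hnot
  have := hN n _ ((le_max_left _ _).trans hn) (hinsert n A ((le_max_right _ _).trans hn) hA)
  rw [Finset.card_insert_of_notMem hnot] at this
  omega

/-- Jointly large sets are witnessed by sequences that are eventually `true`. -/
theorem jointlyLarge_iff_exists_padTrue {f : (ℕ → Bool) → List Bool → ℝ≥0} (hf : LowerOpen f)
    {b₁ : Cantor} {m₁ n : ℕ} {A : Finset (List Bool)} :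
    JointlyLarge f b₁ m₁ n A ↔ (∀ w ∈ A, w.length = n) ∧ ∃ τ : List Bool,
      τ.take m₁ = b₁.take m₁ ∧ (∀ i < n + 1, m₁ ≤ i → padTrue τ i = false) ∧
        ∀ w ∈ A, 1 < f (padTrue τ) w := by
  refine and_congr_right fun _ => ⟨?_, ?_⟩
  · rintro ⟨b, hb, hag, hzero, hlarge⟩
    obtain ⟨m, hm⟩ := hf.finset hb A hlarge
    have hτ := padTrue_take_agree b (max m (max m₁ (n + 1)))
    refine ⟨Cantor.take b (max m (max m₁ (n + 1))), ?_, fun i hi hmi => ?_,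
      hm _ (padTrue_infinitelyOften _) (hτ.symm.mono (le_max_left _ _))⟩
    · refine List.ext_getElem (by simp [Cantor.take]) fun i hi hi' => ?_
      have : i < m₁ := by simpa [Cantor.take] using hi'
      simp [Cantor.take, hag i this]
    · rw [hτ i (lt_max_of_lt_right (lt_max_of_lt_right hi))]
      exact hzero i hmi (Nat.le_of_lt_succ hi)
  · rintro ⟨τ, hτ, hzero, hlarge⟩
    refine ⟨padTrue τ, padTrue_infinitelyOften τ, fun i hi => ?_,
      fun i hi hin => hzero i (Nat.lt_succ_of_le hin) hi, hlarge⟩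
    have h1 : (τ.take m₁)[i]? = some (b₁ i) := by
      rw [hτ]
      simp [Cantor.take, hi]
    rw [List.getElem?_take_of_lt hi] at h1
    simp [padTrue, h1]

theorem PrimrecRel.forall_lt_param {α : Type*} [Primcodable α] {R : ℕ → α → Prop}
    (hR : PrimrecRel R) : PrimrecRel fun (n : ℕ) (a : α) => ∀ i < n, R i a :=
  (hR.forall_mem_list.comp (Primrec.list_range.comp Primrec.fst) Primrec.snd).of_eq (by simp)

theorem PrimrecRel.exists_lt_param {α : Type*} [Primcodable α] {R : ℕ → α → Prop}
    (hR : PrimrecRel R) : PrimrecRel fun (n : ℕ) (a : α) => ∃ i < n, R i a :=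
  (hR.exists_mem_list.comp (Primrec.list_range.comp Primrec.fst) Primrec.snd).of_eq (by simp)

theorem PrimrecPred.list_nodup {α : Type*} [Primcodable α] :
    PrimrecPred fun l : List α => l.Nodup := by
  classical
  have hne : PrimrecRel fun (j : ℕ) (x : ℕ × List α) => ¬ x.2[x.1]? = x.2[j]? :=
    (Primrec.eq.comp (Primrec.list_getElem?.comp (Primrec.snd.comp Primrec.snd)
      (Primrec.fst.comp Primrec.snd))
      (Primrec.list_getElem?.comp (Primrec.snd.comp Primrec.snd) Primrec.fst)).not
  have hj : PrimrecPred fun x : ℕ × List α => ∀ j < x.1, ¬ x.2[x.1]? = x.2[j]? :=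
    hne.forall_lt_param.comp Primrec.fst Primrec.id
  have hj' : PrimrecRel fun (i : ℕ) (l : List α) => ∀ j < i, ¬ l[i]? = l[j]? := hj
  refine (hj'.forall_lt_param.comp Primrec.list_length Primrec.id).of_eq fun l => ?_
  rw [List.nodup_iff_getElem?_ne_getElem?]
  exact ⟨fun h i j hij hjl heq => h j hjl i hij heq.symm,
    fun h j hjl i hij heq => h i j hij hjl heq.symm⟩

/-- Both values of the bit S(n) have finite certificates, so S is decidable by Post's theorem. -/
theorem isDecidable_of_lowerOpen {f : (ℕ → Bool) → List Bool → ℝ≥0} (hf : LowerOpen f)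
    {q : (List Bool × List Bool) × ℕ → Prop} (hq : PrimrecPred q)
    (hqf : ∀ τ w, 1 < f (padTrue τ) w ↔ ∃ k, q ((τ, w), k))
    (hsm : ∀ b, InfinitelyOften b → IsOddsSupermartingale (levelOdds b) (f b)) {S : Cantor}
    (hlim : ∀ b, InfinitelyOften b → ∃ N, ∀ n, N ≤ n → 1 < f b (S.take n)) : S.IsDecidable := by
  classical
  obtain ⟨b₁, m₁, N, k, K, hK, hmem, hlong⟩ := exists_jointlyLarge_family hf hsm hlim
  obtain ⟨l, hl⟩ := exists_branching_level (K := K)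
    (𝒜 := {A | ∃ n, N ≤ n ∧ JointlyLarge f b₁ m₁ n A ∧ k ≤ A.card})
    (fun A ⟨n, _, hA, _⟩ => hK n A hA) (fun M => by
      obtain ⟨n, A, hn, hA, hkA⟩ := hlong (max M N)
      exact ⟨A, ⟨n, (le_max_right _ _).trans hn, hA, hkA⟩, fun w hw => by
        rw [hA.1 w hw]; exact (le_max_left _ _).trans hn⟩)
  have hbit : ∀ n n', n < n' → (S.take n')[n]? = some (S n) := fun n n' h => by
    simp [Cantor.take, h]
  have htake : ∀ n', l ≤ n' → (S.take n').take l = S.take l := fun n' h => by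
    simp [Cantor.take, ← List.map_take, List.take_range, h]
  have hre : ∀ β : Bool, REPred fun n => S n = β := by
    intro β
    -- A certificate (τ, L, n', r) for S(n) = β: τ gives the witnessing `padTrue τ`, L lists a
    -- jointly large set at length n', and r bounds the searches verifying that its members have
    -- values above 1. Every member extending S↾l must have bit β at n.
    let Q : ℕ × (List Bool × List (List Bool) × ℕ × ℕ) → Prop := fun x =>
      (N ≤ x.2.2.2.1 ∧ l ≤ x.2.2.2.1 ∧ x.1 < x.2.2.2.1) ∧
      (x.2.2.1.Nodup ∧ k ≤ x.2.2.1.length) ∧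
      (x.2.1.take m₁ = Cantor.take b₁ m₁ ∧
        ∀ i < x.2.2.2.1 + 1, ¬ (m₁ ≤ i ∧ x.2.1.getD i true = true)) ∧
      ∀ w ∈ x.2.2.1, w.length = x.2.2.2.1 ∧ (∃ j < x.2.2.2.2, q ((x.2.1, w), j)) ∧
        (¬ w.take l = S.take l ∨ w[x.1]? = some β)
    have hQ : PrimrecPred Q := by
      let X := ℕ × (List Bool × List (List Bool) × ℕ × ℕ)
      have hn : Primrec fun x : X => x.1 := Primrec.fst
      have hτ : Primrec fun x : X => x.2.1 := Primrec.fst.comp Primrec.snd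
      have hL : Primrec fun x : X => x.2.2.1 :=
        Primrec.fst.comp (Primrec.snd.comp Primrec.snd)
      have hn' : Primrec fun x : X => x.2.2.2.1 :=
        Primrec.fst.comp (Primrec.snd.comp (Primrec.snd.comp Primrec.snd))
      have hr : Primrec fun x : X => x.2.2.2.2 :=
        Primrec.snd.comp (Primrec.snd.comp (Primrec.snd.comp Primrec.snd))
      have hzero : PrimrecRel fun (i : ℕ) (x : X) => ¬ (m₁ ≤ i ∧ x.2.1.getD i true = true) := by
        refine PrimrecPred.not (PrimrecPred.and
          (Primrec.nat_le.comp (Primrec.const m₁) Primrec.fst) (Primrec.eq.comp ?_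
            (Primrec.const true)))
        exact Primrec.option_getD.comp
          (Primrec.list_getElem?.comp (hτ.comp Primrec.snd) Primrec.fst) (Primrec.const true)
      have hq' : PrimrecRel fun (j : ℕ) (y : List Bool × X) => q ((y.2.2.1, y.1), j) :=
        hq.comp (Primrec.pair (Primrec.pair (hτ.comp (Primrec.snd.comp Primrec.snd))
          (Primrec.fst.comp Primrec.snd)) Primrec.fst)
      have hqr : PrimrecPred fun y : List Bool × X => ∃ j < y.2.2.2.2.2, q ((y.2.2.1, y.1), j) :=
        hq'.exists_lt_param.comp (hr.comp Primrec.snd) Primrec.id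
      have hw : PrimrecRel fun (w : List Bool) (x : X) => w.length = x.2.2.2.1 ∧
          (∃ j < x.2.2.2.2, q ((x.2.1, w), j)) ∧
          (¬ w.take l = S.take l ∨ w[x.1]? = some β) := by
        refine PrimrecPred.and (Primrec.eq.comp (Primrec.list_length.comp Primrec.fst)
          (hn'.comp Primrec.snd)) (PrimrecPred.and hqr (PrimrecPred.or (PrimrecPred.not
            (Primrec.eq.comp (Primrec.list_take.comp (Primrec.const l) Primrec.fst)
              (Primrec.const _))) ?_))
        exact Primrec.eq.comp (Primrec.list_getElem?.comp Primrec.fst (hn.comp Primrec.snd))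
          (Primrec.const _)
      refine PrimrecPred.and (PrimrecPred.and (Primrec.nat_le.comp (Primrec.const N) hn')
        (PrimrecPred.and (Primrec.nat_le.comp (Primrec.const l) hn') (Primrec.nat_lt.comp hn hn')))
        (PrimrecPred.and (PrimrecPred.and (PrimrecPred.list_nodup.comp hL)
          (Primrec.nat_le.comp (Primrec.const k) (Primrec.list_length.comp hL)))
          (PrimrecPred.and (PrimrecPred.and (Primrec.eq.comp
            (Primrec.list_take.comp (Primrec.const m₁) hτ) (Primrec.const _))
            (hzero.forall_lt_param.comp (Primrec.succ.comp hn') Primrec.id))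
            (hw.forall_mem_list.comp hL Primrec.id)))
    refine REPred.of_exists hQ fun n => ⟨fun hβ => ?_, ?_⟩
    -- Completeness: the set given by the branching level contains a prefix of S, so its members
    -- over S↾l share the bit S(n).
    · obtain ⟨A, ⟨n', hN, hA, hkA⟩, hlen, hsame⟩ := hl n
      have hSA := hmem n' A hN hA hkA
      have hn' := hlen _ hSA
      rw [S.length_take] at hn'
      obtain ⟨hA1, τ, hτ, hzero, hlarge⟩ := (jointlyLarge_iff_exists_padTrue hf).1 hA
      have hj : ∀ w, ∃ j, w ∈ A → q ((τ, w), j) := fun w => by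
        by_cases hw : w ∈ A
        · obtain ⟨j, hj⟩ := (hqf τ w).1 (hlarge w hw)
          exact ⟨j, fun _ => hj⟩
        · exact ⟨0, fun h => absurd h hw⟩
      choose j hj using hj
      refine ⟨(τ, A.toList, n', A.sup j + 1), ⟨hN, hn'.2, hn'.1⟩,
        ⟨A.nodup_toList, by simpa using hkA⟩, ⟨hτ, fun i hi h => ?_⟩, fun w hw => ?_⟩
      · have := hzero i hi h.1
        rw [padTrue, h.2] at this
        cases this
      · rw [Finset.mem_toList] at hw
        refine ⟨hA1 w hw, ⟨j w, Nat.lt_succ_of_le (Finset.le_sup hw), hj w hw⟩, ?_⟩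
        refine or_iff_not_imp_left.2 fun h => ?_
        rw [hsame w hw _ hSA ((not_not.1 h).trans (htake n' hn'.2).symm), hbit n n' hn'.1, hβ]
    -- Soundness: any certified set contains S↾n', so the bit it certifies is that of S.
    · rintro ⟨⟨τ, L, n', r⟩, ⟨hN, hln, hn⟩, ⟨hnodup, hkL⟩, ⟨hτ, hzero⟩, hL⟩
      have hA : JointlyLarge f b₁ m₁ n' L.toFinset := by
        refine (jointlyLarge_iff_exists_padTrue hf).2 ⟨fun w hw => (hL w (by simpa using hw)).1, τ,
          hτ, fun i hi hmi => ?_, fun w hw => ?_⟩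
        · exact Bool.eq_false_iff.2 fun h => hzero i hi ⟨hmi, h⟩
        · obtain ⟨j, -, hj⟩ := (hL w (by simpa using hw)).2.1
          exact (hqf τ w).2 ⟨j, hj⟩
      have hSA := hmem n' _ hN hA (by rwa [List.toFinset_card_of_nodup hnodup])
      have hSL := (hL _ (List.mem_toFinset.1 hSA)).2.2
      rw [htake n' hln, hbit n n' hn] at hSL
      simpa using hSL
  refine ComputablePred.computable_iff_re_compl_re'.2 ⟨hre true, (hre false).of_eq fun n => ?_⟩
  simp

theorem isDecidable_of_semidecides {M : OracleMachine} {ε : ℕ} {F : OddsFn → List Bool → ℝ≥0}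
    (hM : Semidecides M ε F) {S : Cantor} (hF : SucceedsInLiminf F {S}) : S.IsDecidable := by
  obtain ⟨q, hq, hqf⟩ := hM.exists_primrecPred 1
  refine isDecidable_of_lowerOpen (f := fun b => F (levelOdds b)) (fun b hb c w => hM.open hb) hq
    (by simpa using hqf) (fun b hb => (hF _ (levelOdds_acceptable hb)).1) fun b hb => ?_
  have hlim := (hF _ (levelOdds_acceptable hb)).2 S rfl
  -- Of the infinite limit inferior, only that it exceeds 1 is used.
  have hev := Filter.eventually_lt_of_lt_liminf (b := (1 : ℝ≥0∞)) (by rw [hlim]; simp)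
  obtain ⟨N, hN⟩ := Filter.eventually_atTop.1 hev
  exact ⟨N, fun n hn => by exact_mod_cast hN n hn⟩

theorem mainTheorem4 (S : Cantor) (hS : AlgorithmicSPDZ {S} ∨ ComputableSPDZ {S}) :
    S.IsDecidable := by
  rcases hS with ⟨F, hF, hX⟩ | ⟨F, hF, hX⟩
  · obtain ⟨M, hM⟩ := hF.exists_semidecides
    exact isDecidable_of_semidecides hM hX
  · obtain ⟨M, hM⟩ := hF.exists_semidecides
    exact isDecidable_of_semidecides hM hX
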